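/- Let $\Sigma^+\neq\emptyset$ be a one-sided subshift of finite type over a finite alphabet, i.e. the set of all sequences $x=(x_0,x_1,\dots)$ in which no word (pattern) from a given finite list occurs, and let $\sigma:\Sigma^+\to\Sigma^+$, $(\sigma x)_k=x_{k+1}$, be the shift. Assume that $\sigma$ is topologically mixing. Fix $0<\lambda<1$ and endow $\Sigma^+$ with the metric $d(x,y)=\lambda^{n}$, $n=\min\{k\ge 0 : x_k\ne y_k\}$, for $x\neq y$. Fix $0<\alpha\le 1$. For $\gamma>0$ let $C^\gamma(\Sigma^+,\mathbb R)$ be the space of $\gamma$-Hölder functions $A:\Sigma^+\to\mathbb R$ with the norm $$\|A\|_\gamma=\sup_{x\ne y}\frac{|A(x)-A(y)|}{d(x,y)^\gamma}+\sup_{x}|A(x)| ,$$ let $C^\gamma_0\subseteq C^\gamma(\Sigma^+,\mathbb R)$ be the subset of functions with topological pressure $P(A)=0$, and let $C^{\alpha+}_0$ be the closure of $\bigcup_{\gamma>\alpha}C^\gamma_0$ in $C^\alpha(\Sigma^+,\mathbb R)$, with the topology of $\|\cdot\|_\alpha$. Here $$P(A)=\lim_{n\to\infty}\frac1n\log\sum_{w}\exp\Big(\sup_{x\in[w]}\sum_{k=0}^{n-1}A(\sigma^kx)\Big),$$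 the sum being over the words $w$ of length $n$ whose cylinder $[w]=\{x\in\Sigma^+ : x_0\cdots x_{n-1}=w\}$ is non-empty. A maximizing measure for $A$ is a $\sigma$-invariant Borel probability measure $\mu$ such that $\int A\,d\mu\ge\int A\,d\nu$ for every $\sigma$-invariant Borel probability measure $\nu$. **Theorem C.** There is a dense subset $\mathcal D\subseteq C^{\alpha+}_0$ such that every $A\in\mathcal D$ has a unique maximizing measure $\mu$, and the pair $(A,\mu)$ has the continuously varying support property: whenever $A_n\in C^\alpha_0$ converge to $A$ in the norm $\|\cdot\|_\alpha$ and $\mu_n$ is a maximizing measure for $A_n$ for each $n$, then $\mu_n\to\mu$ in the weak* topology and $\operatorname{supp}(\mu_n)\to\operatorname{supp}(\mu)$ in the Hausdorff metric. -/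

import Mathlib

open MeasureTheory Filter Topology
open scoped NNReal ENNReal BoundedContinuousFunction

noncomputable section

/-! ## One-sided subshifts of finite type -/

/-- The one-sided subshift of finite type over the alphabet `S` given by the finite set `F` of
forbidden patterns: all sequences `x₀ x₁ x₂ …` in which no pattern of `F` occurs at any position.
The parameter `lam ∈ (0,1)` only enters through the metric. -/
def SFT {S : Type*} [Inhabited S] (F : Finset (SymbolicDynamics.FullShift.Pattern S ℕ))
    (_lam : Set.Ioo (0 : ℝ) 1) : Type _ :=
  {x : ℕ → S // x ∈ SymbolicDynamics.FullShift.forbidden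
    (F : Set (SymbolicDynamics.FullShift.Pattern S ℕ))}

namespace SFT

variable {S : Type*} [Inhabited S] {F : Finset (SymbolicDynamics.FullShift.Pattern S ℕ)}
  {lam : Set.Ioo (0 : ℝ) 1}

open scoped Classical in
/-- The metric `d(x, y) = lam ^ n`, where `n = min {k | x k ≠ y k}` (and `d(x, x) = 0`). -/
instance : MetricSpace (SFT F lam) where
  dist x y := if x = y then 0 else (lam : ℝ) ^ PiNat.firstDiff x.1 y.1
  dist_self x := by simp
  dist_comm x y := by
    simp only [eq_comm (a := x) (b := y), PiNat.firstDiff_comm x.1 y.1]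
  dist_triangle x y z := by
    have h0 : (0 : ℝ) < lam := lam.2.1
    have h1 : (lam : ℝ) ≤ 1 := lam.2.2.le
    by_cases hxz : x = z
    · simp only [hxz, if_true]
      positivity
    by_cases hxy : x = y
    · simp [hxy]
    by_cases hyz : y = z
    · simp [hyz]
    have hne : x.1 ≠ z.1 := fun h => hxz (Subtype.ext h)
    simp only [hxz, hxy, hyz, if_false]
    rcases min_le_iff.1 (PiNat.min_firstDiff_le x.1 y.1 z.1 hne) with h | h
    · have := pow_le_pow_of_le_one h0.le h1 h
      have : 0 < (lam : ℝ) ^ PiNat.firstDiff y.1 z.1 := by positivity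
      linarith
    · have := pow_le_pow_of_le_one h0.le h1 h
      have : 0 < (lam : ℝ) ^ PiNat.firstDiff x.1 y.1 := by positivity
      linarith
  eq_of_dist_eq_zero {x y} h := by
    by_contra hxy
    have h0 : (0 : ℝ) < lam := lam.2.1
    have h1 : (lam : ℝ) ^ PiNat.firstDiff x.1 y.1 = 0 := by simpa [hxy] using h
    exact (pow_pos h0 _).ne' h1

instance : MeasurableSpace (SFT F lam) := borel _

instance : BorelSpace (SFT F lam) := ⟨rfl⟩

/-- The shift map `σ (x₀, x₁, x₂, …) = (x₁, x₂, …)`. -/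
def shift (x : SFT F lam) : SFT F lam :=
  ⟨fun n => x.1 (n + 1), fun p hp g hocc => x.2 p hp (g + 1) fun h hh => by
    have := hocc h hh
    rwa [Nat.add_right_comm g 1 h]⟩

/-- The cylinder of all points of the subshift that begin with the word `w`. -/
def cylinder {n : ℕ} (w : Fin n → S) : Set (SFT F lam) := {x | ∀ i : Fin n, x.1 i = w i}

open scoped Classical in
/-- The `n`-th partition function `∑_w exp (sup_{x ∈ [w]} ∑_{k < n} A (σ^k x))`, the sum being over
all words `w` of length `n` whose cylinder `[w]` is not empty. -/
def partitionFunction [Fintype S] (A : SFT F lam → ℝ) (n : ℕ) : ℝ :=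
  ∑ w : Fin n → S with (cylinder w : Set (SFT F lam)).Nonempty,
    Real.exp (sSup ((fun x => birkhoffSum shift A n x) '' cylinder w))

/-- The topological pressure `P(A) = lim_n (1/n) log Z_n(A)` of a continuous function `A`
(the limit exists, by subadditivity). -/
def pressure [Fintype S] (A : SFT F lam → ℝ) : ℝ :=
  limsup (fun n : ℕ => Real.log (partitionFunction A n) / n) atTop

end SFT

/-- Topological mixing of a map. -/
def IsTopologicallyMixing {X : Type*} [TopologicalSpace X] (f : X → X) : Prop :=
  ∀ U V : Set X, IsOpen U → IsOpen V → U.Nonempty → V.Nonempty →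
    ∃ N : ℕ, ∀ n ≥ N, (U ∩ f^[n] ⁻¹' V).Nonempty

/-! ## Hölder functions -/

/-- The bounded continuous functions that are `α`-Hölder. (If `α > 0` and `X` is bounded, every
`α`-Hölder function is bounded and continuous.) -/
def holderSubmodule (X : Type*) [MetricSpace X] (α : ℝ≥0) : Submodule ℝ (X →ᵇ ℝ) where
  carrier := {f | MemHolder α f}
  add_mem' hf hg := MemHolder.add hf hg
  zero_mem' := memHolder_zero
  smul_mem' _ _ hf := MemHolder.smul hf

/-- The space `C^α(X, ℝ)` of `α`-Hölder functions; its topology is that of the Hölder norm. -/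
def HolderSpace (X : Type*) [MetricSpace X] (α : ℝ≥0) : Type _ := holderSubmodule X α

namespace HolderSpace

variable {X : Type*} [MetricSpace X] {α : ℝ≥0}

instance : AddCommGroup (HolderSpace X α) := inferInstanceAs (AddCommGroup (holderSubmodule X α))

instance : Module ℝ (HolderSpace X α) := inferInstanceAs (Module ℝ (holderSubmodule X α))

instance : CoeFun (HolderSpace X α) fun _ => X → ℝ := ⟨fun A => A.1⟩

/-- The norm `‖A‖_α = Hold_α(A) + ‖A‖₀`, where `‖A‖₀` is the supremum norm and `Hold_α(A)` the
least Hölder constant of `A`. -/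
instance : NormedAddCommGroup (HolderSpace X α) :=
  AddGroupNorm.toNormedAddCommGroup
    { toFun := fun A => (nnHolderNorm α A : ℝ) + ‖A.1‖
      map_zero' := by
        have h : nnHolderNorm α (0 : X → ℝ) = 0 := nnHolderNorm_zero _ α
        have h' : (nnHolderNorm α (0 : X → ℝ) : ℝ) + ‖(0 : X →ᵇ ℝ)‖ = 0 := by simp [h]
        exact h'
      add_le' := fun A B => by
        have h1 : (nnHolderNorm α ((A : X → ℝ) + (B : X → ℝ)) : ℝ) ≤
            nnHolderNorm α (A : X → ℝ) + nnHolderNorm α (B : X → ℝ) := by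
          exact_mod_cast MemHolder.nnHolderNorm_add_le A.2 B.2
        have h2 : ‖A.1 + B.1‖ ≤ ‖A.1‖ + ‖B.1‖ := norm_add_le _ _
        have h3 : (nnHolderNorm α ((A : X → ℝ) + (B : X → ℝ)) : ℝ) + ‖A.1 + B.1‖ ≤
            (nnHolderNorm α (A : X → ℝ) + ‖A.1‖) + (nnHolderNorm α (B : X → ℝ) + ‖B.1‖) := by
          linarith
        exact h3
      neg' := fun A => by
        have h1 : nnHolderNorm α ((-1 : ℝ) • (A : X → ℝ)) = nnHolderNorm α (A : X → ℝ) := by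
          rw [MemHolder.nnHolderNorm_smul A.2]; simp
        rw [neg_one_smul] at h1
        have h2 : (nnHolderNorm α (-(A : X → ℝ)) : ℝ) + ‖-A.1‖ =
            nnHolderNorm α (A : X → ℝ) + ‖A.1‖ := by rw [h1, norm_neg]
        exact h2
      eq_zero_of_map_eq_zero' := fun A hA => by
        have h1 : (nnHolderNorm α (A : X → ℝ) : ℝ) + ‖A.1‖ = 0 := hA
        have h2 : ‖A.1‖ = 0 :=
          le_antisymm (by linarith [(nnHolderNorm α (A : X → ℝ)).coe_nonneg]) (norm_nonneg _)
        exact Subtype.ext (norm_eq_zero.1 h2) }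

end HolderSpace

section Maximizing

variable {S : Type*} [Fintype S] [Inhabited S]
  (F : Finset (SymbolicDynamics.FullShift.Pattern S ℕ)) (lam : Set.Ioo (0 : ℝ) 1) (α : ℝ≥0)

/-- `C^α_0`: the `α`-Hölder functions of zero topological pressure. -/
def zeroPressure : Set (HolderSpace (SFT F lam) α) := {A | SFT.pressure A = 0}

/-- `C^{α+}_0`: the closure, in the `α`-Hölder topology, of the union over `γ > α` of the sets
`C^γ_0`. -/
def zeroPressurePlus : Set (HolderSpace (SFT F lam) α) :=
  closure {A | SFT.pressure A = 0 ∧ ∃ γ : ℝ≥0, α < γ ∧ MemHolder γ A}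

variable {F lam α}

/-- `μ` is a maximizing measure for `A`: it is a shift invariant Borel probability and it maximizes
`∫ A dν` among all shift invariant Borel probabilities `ν`. -/
def IsMaximizingMeasure (A : SFT F lam → ℝ) (μ : ProbabilityMeasure (SFT F lam)) : Prop :=
  MeasurePreserving SFT.shift (μ : Measure (SFT F lam)) μ ∧
    ∀ ν : ProbabilityMeasure (SFT F lam),
      MeasurePreserving SFT.shift (ν : Measure (SFT F lam)) ν → ∫ x, A x ∂ν ≤ ∫ x, A x ∂μ

/-- Strong convergence of probability measures: weak* convergence, together with convergence of the
supports in the Hausdorff metric. -/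
def StronglyConverges {X : Type*} [MetricSpace X] [MeasurableSpace X] [BorelSpace X]
    (ν : ℕ → ProbabilityMeasure X) (μ : ProbabilityMeasure X) : Prop :=
  Tendsto ν atTop (𝓝 μ) ∧
    Tendsto (fun n => Metric.hausdorffEDist (ν n : Measure X).support (μ : Measure X).support)
      atTop (𝓝 0)

/-- The pair `(A, μ)` has the continuously varying support property: whenever `A n → A` in `C^α_0`
and `μ n` is a maximizing measure for `A n`, the sequence `μ n` converges strongly to `μ`. -/
def HasContinuouslyVaryingSupport (A : HolderSpace (SFT F lam) α)
    (μ : ProbabilityMeasure (SFT F lam)) : Prop :=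
  ∀ (An : ℕ → HolderSpace (SFT F lam) α) (μn : ℕ → ProbabilityMeasure (SFT F lam)),
    (∀ n, An n ∈ zeroPressure F lam α) → Tendsto An atTop (𝓝 A) →
    (∀ n, IsMaximizingMeasure (An n) (μn n)) → StronglyConverges μn μ

end Maximizing

end

/-! Near every generator of `zeroPressurePlus` there is a function on whose whole `α`-Hölder
neighbourhood one periodic orbit carries the only maximizing measure. Measures maximizing functions
that converge to it are then eventually equal to the orbit measure, so both convergences are
trivial.

To build it, let `A` be `γ`-Hölder with `γ > α` and zero pressure. The gap in exponents makes `A`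
close in `C^α` to a function `A'` of finitely many coordinates (`exists_dependsOnFirst_approx`).
Cutting loops out of words shows that a periodic orbit maximizes the mean of `A'`, with Birkhoff
sums at most `n * mean + C` (`exists_maximal_periodic`). Subtract a small multiple of the indicator
of the points away from this orbit, then the pressure, which is small because pressure is
1-Lipschitz for the supremum norm (`pressure_le`).

The orbit is robust because a small Hölder perturbation gains little while an orbit shadows the
periodic one: the distances sum geometrically. Beyond the mean, its gain is bounded by a small
multiple of the number of visits away, plus a constant (`birkhoffSum_le_add_awayFromOrbit`), and the
penalty absorbs this. -/

noncomputable section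

/-! ### Coordinates, the metric, and locally constant approximation -/

namespace SFT

variable {S : Type*} [Inhabited S] {F : Finset (SymbolicDynamics.FullShift.Pattern S ℕ)}
  {lam : Set.Ioo (0 : ℝ) 1}

lemma shift_iterate_apply (k : ℕ) (x : SFT F lam) (t : ℕ) :
    (shift^[k] x).1 t = x.1 (t + k) := by
  induction k generalizing x with
  | zero => rfl
  | succ k ih =>
    rw [Function.iterate_succ_apply, ih]
    rfl

lemma dist_le_pow_iff (x y : SFT F lam) (M : ℕ) :
    dist x y ≤ (lam : ℝ) ^ M ↔ ∀ t < M, x.1 t = y.1 t := by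
  have h0 : (0 : ℝ) < lam := lam.2.1
  by_cases hxy : x = y
  · subst hxy
    simp [h0.le]
  have hne : x.1 ≠ y.1 := fun h => hxy (Subtype.ext h)
  have hd : dist x y = (lam : ℝ) ^ PiNat.firstDiff x.1 y.1 := if_neg hxy
  rw [hd, pow_le_pow_iff_right_of_lt_one₀ h0 lam.2.2, ← PiNat.mem_cylinder_iff_le_firstDiff hne]
  rfl

lemma dist_le_one (x y : SFT F lam) : dist x y ≤ 1 := by
  simpa using (dist_le_pow_iff x y 0).2 (by simp)

lemma dist_shift_le (x y : SFT F lam) : dist (shift x) (shift y) ≤ (lam : ℝ)⁻¹ * dist x y := by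
  have h0 : (0 : ℝ) < lam := lam.2.1
  by_cases hxy : x = y
  · subst hxy
    simp
  have hd : dist x y = (lam : ℝ) ^ PiNat.firstDiff x.1 y.1 := if_neg hxy
  rw [hd]
  rcases hn : PiNat.firstDiff x.1 y.1 with _ | n
  · rw [pow_zero, mul_one]
    exact (dist_le_one _ _).trans ((one_le_inv₀ h0).2 lam.2.2.le)
  · rw [pow_succ', inv_mul_cancel_left₀ h0.ne', dist_le_pow_iff]
    intro t ht
    exact PiNat.apply_eq_of_lt_firstDiff (x := x.1) (y := y.1) (n := t + 1) (by omega)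

lemma continuous_shift : Continuous (shift : SFT F lam → SFT F lam) := by
  have h0 : (0 : ℝ) < lam := lam.2.1
  refine (LipschitzWith.of_dist_le_mul (K := ⟨(lam : ℝ)⁻¹, by positivity⟩) ?_).continuous
  exact dist_shift_le

/-- `f x` only depends on the first `M` coordinates of `x`. -/
def DependsOnFirst (M : ℕ) {β : Type*} (f : SFT F lam → β) : Prop :=
  ∀ x y : SFT F lam, (∀ t < M, x.1 t = y.1 t) → f x = f y

lemma DependsOnFirst.mono {β : Type*} {f : SFT F lam → β} {M N : ℕ} (hf : DependsOnFirst M f)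
    (h : M ≤ N) : DependsOnFirst N f :=
  fun x y hxy => hf x y fun t ht => hxy t (by omega)

lemma DependsOnFirst.isOpen {U : Set (SFT F lam)} {M : ℕ} (hU : DependsOnFirst M (· ∈ U)) :
    IsOpen U := by
  rw [Metric.isOpen_iff]
  refine fun x hx => ⟨(lam : ℝ) ^ M, pow_pos lam.2.1 _, fun y hy => ?_⟩
  have h := hU y x ((dist_le_pow_iff y x M).1 (Metric.mem_ball.1 hy).le)
  exact h.mpr hx

/-- A function of finitely many coordinates is Hölder of every exponent. -/
lemma DependsOnFirst.abs_sub_le {f : SFT F lam → ℝ} {M : ℕ} (hf : DependsOnFirst M f) {b : ℝ}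
    (hb : ∀ x, |f x| ≤ b) {γ : ℝ} (hγ : 0 ≤ γ) (x y : SFT F lam) :
    |f x - f y| ≤ 2 * b / ((lam : ℝ) ^ M) ^ γ * dist x y ^ γ := by
  have hM : (0 : ℝ) < (lam : ℝ) ^ M := pow_pos lam.2.1 _
  have hb0 : 0 ≤ b := (abs_nonneg _).trans (hb x)
  by_cases h : dist x y ≤ (lam : ℝ) ^ M
  · rw [hf x y ((dist_le_pow_iff x y M).1 h), sub_self, abs_zero]
    positivity
  · have h1 : ((lam : ℝ) ^ M) ^ γ ≤ dist x y ^ γ :=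
      Real.rpow_le_rpow hM.le (le_of_not_ge h) hγ
    have h2 : 0 < ((lam : ℝ) ^ M) ^ γ := Real.rpow_pos_of_pos hM _
    calc |f x - f y| ≤ |f x| + |f y| := abs_sub _ _
      _ ≤ 2 * b := by linarith [hb x, hb y]
      _ = 2 * b / ((lam : ℝ) ^ M) ^ γ * ((lam : ℝ) ^ M) ^ γ := by field_simp
      _ ≤ _ := by gcongr

/-- A `γ`-Hölder function is close in `C^α`, `α < γ`, to the function that takes on every cylinder
of length `N` the value at a chosen point of the cylinder. -/
lemma exists_dependsOnFirst_approx [Nonempty (SFT F lam)] {A : SFT F lam → ℝ} {C α γ : ℝ}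
    (hC : 0 ≤ C) (hα : 0 ≤ α) (hαγ : α ≤ γ)
    (hA : ∀ x y, |A x - A y| ≤ C * dist x y ^ γ) (N : ℕ) :
    ∃ A' : SFT F lam → ℝ, DependsOnFirst N A' ∧ (∀ x, ∃ y, A' x = A y) ∧
      (∀ x, |A' x - A x| ≤ 2 * C * ((lam : ℝ) ^ N) ^ (γ - α)) ∧
      ∀ x y, |(A' x - A x) - (A' y - A y)| ≤
        2 * C * ((lam : ℝ) ^ N) ^ (γ - α) * dist x y ^ α := by
  let W : SFT F lam → Fin N → S := fun x i => x.1 i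
  have hW : ∀ x y, W x = W y ↔ dist x y ≤ (lam : ℝ) ^ N := fun x y => by
    rw [dist_le_pow_iff]
    exact ⟨fun h t ht => congrFun h ⟨t, ht⟩, fun h => funext fun i => h i i.2⟩
  have hL : (0 : ℝ) < (lam : ℝ) ^ N := pow_pos lam.2.1 _
  have hL1 : (lam : ℝ) ^ N ≤ 1 := pow_le_one₀ lam.2.1.le lam.2.2.le
  set L : ℝ := (lam : ℝ) ^ N
  have hsplit : L ^ γ = L ^ α * L ^ (γ - α) := by
    rw [← Real.rpow_add hL]; congr 1; ring
  have hLα : 0 ≤ L ^ α := Real.rpow_nonneg hL.le _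
  have hLγ : 0 ≤ L ^ (γ - α) := Real.rpow_nonneg hL.le _
  have hLα1 : L ^ α ≤ 1 := Real.rpow_le_one hL.le hL1 hα
  have hrep : ∀ x, W (Function.invFun W (W x)) = W x := fun x => Function.invFun_eq ⟨x, rfl⟩
  have hclose : ∀ x, |A (Function.invFun W (W x)) - A x| ≤ C * (L ^ α * L ^ (γ - α)) := fun x => by
    refine (hA _ _).trans ?_
    rw [← hsplit]
    have := Real.rpow_le_rpow dist_nonneg ((hW _ _).1 (hrep x)) (hα.trans hαγ)
    gcongr
  refine ⟨fun x => A (Function.invFun W (W x)), fun x y h => ?_, fun x => ⟨_, rfl⟩, fun x => ?_,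
    fun x y => ?_⟩
  · simp only
    rw [(hW x y).2 ((dist_le_pow_iff x y N).2 h)]
  · refine (hclose x).trans ?_
    have : C * (L ^ α * L ^ (γ - α)) ≤ C * (1 * L ^ (γ - α)) := by gcongr
    have h2 : 0 ≤ C * L ^ (γ - α) := by positivity
    linarith
  -- If `x` and `y` share their word, the chosen values cancel and the surplus `γ - α` of the
  -- exponent gives the small factor. Otherwise each error is at most `C * L ^ γ`, and `L ^ α ≤ dist
  -- x y ^ α`.
  · by_cases h : dist x y ≤ L
    · simp only [(hW x y).2 h, sub_sub_sub_cancel_left]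
      refine (hA y x).trans ?_
      rw [dist_comm y x]
      have h1 : dist x y ^ γ ≤ dist x y ^ α * L ^ (γ - α) := by
        have : dist x y ^ γ = dist x y ^ α * dist x y ^ (γ - α) := by
          rw [← Real.rpow_add_of_nonneg dist_nonneg hα (by linarith)]; congr 1; ring
        rw [this]
        have := Real.rpow_le_rpow dist_nonneg h (sub_nonneg.2 hαγ)
        have h0 : 0 ≤ dist x y ^ α := by positivity
        gcongr
      have h2 : C * dist x y ^ γ ≤ C * (dist x y ^ α * L ^ (γ - α)) := by gcongr
      have h3 : 0 ≤ C * (dist x y ^ α * L ^ (γ - α)) := by positivity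
      nlinarith
    · have h1 : L ^ α ≤ dist x y ^ α := Real.rpow_le_rpow hL.le (le_of_not_ge h) hα
      refine (abs_sub _ _).trans ((add_le_add (hclose x) (hclose y)).trans ?_)
      have : C * (L ^ α * L ^ (γ - α)) ≤ C * (dist x y ^ α * L ^ (γ - α)) := by gcongr
      linarith

/-! ### Monotonicity of the pressure -/

lemma abs_birkhoffSum_le {A : SFT F lam → ℝ} {b : ℝ} (hb : ∀ x, |A x| ≤ b) (n : ℕ)
    (x : SFT F lam) : |birkhoffSum shift A n x| ≤ n * b := by
  refine (Finset.abs_sum_le_sum_abs _ _).trans ?_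
  refine (Finset.sum_le_sum fun k _ => hb _).trans ?_
  simp

variable [Fintype S]

lemma partitionFunction_le {A B : SFT F lam → ℝ} {b c : ℝ} (hb : ∀ x, |B x| ≤ b)
    (h : ∀ x, A x ≤ B x + c) (n : ℕ) :
    partitionFunction A n ≤ Real.exp (n * c) * partitionFunction B n := by
  classical
  unfold partitionFunction
  rw [Finset.mul_sum]
  refine Finset.sum_le_sum fun w hw => ?_
  rw [← Real.exp_add]
  refine Real.exp_le_exp.2 (csSup_le ((Finset.mem_filter.1 hw).2.image _) ?_)
  rintro _ ⟨x, hx, rfl⟩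
  have h1 : birkhoffSum shift A n x ≤ n * c + birkhoffSum shift B n x := by
    unfold birkhoffSum
    refine (Finset.sum_le_sum fun k _ => h _).trans (le_of_eq ?_)
    rw [Finset.sum_add_distrib]
    simp [add_comm]
  -- The bound on `B` is needed here: `sSup` of a set of reals unbounded above is `0`.
  have h2 : birkhoffSum shift B n x ≤ sSup ((fun x => birkhoffSum shift B n x) '' cylinder w) :=
    le_csSup ⟨n * b, by rintro _ ⟨y, _, rfl⟩; exact (abs_le.1 (abs_birkhoffSum_le hb n y)).2⟩
      ⟨x, hx, rfl⟩
  linarith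

lemma partitionFunction_pos [hne : Nonempty (SFT F lam)] (A : SFT F lam → ℝ) (n : ℕ) :
    0 < partitionFunction A n := by
  classical
  obtain ⟨x⟩ := hne
  refine Finset.sum_pos (fun w _ => Real.exp_pos _) ⟨fun i => x.1 i, ?_⟩
  exact Finset.mem_filter.2 ⟨Finset.mem_univ _, ⟨x, fun i => rfl⟩⟩

lemma partitionFunction_zero_le (n : ℕ) :
    partitionFunction (0 : SFT F lam → ℝ) n ≤ (Fintype.card S : ℝ) ^ n := by
  classical
  unfold partitionFunction
  calc _ ≤ ∑ w : Fin n → S with (cylinder w : Set (SFT F lam)).Nonempty, (1 : ℝ) := by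
        refine Finset.sum_le_sum fun w hw => ?_
        rw [← Real.exp_zero]
        refine Real.exp_le_exp.2 (csSup_le ((Finset.mem_filter.1 hw).2.image _) ?_)
        rintro _ ⟨x, _, rfl⟩
        simp [birkhoffSum]
    _ ≤ _ := by
        rw [Finset.sum_const, nsmul_eq_mul, mul_one]
        refine (Nat.cast_le.2 (Finset.card_le_univ _)).trans ?_
        simp

lemma one_le_partitionFunction_zero [hne : Nonempty (SFT F lam)] (n : ℕ) :
    1 ≤ partitionFunction (0 : SFT F lam → ℝ) n := by
  classical
  obtain ⟨x⟩ := hne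
  unfold partitionFunction
  have hmem : (fun i : Fin n => x.1 i) ∈
      Finset.univ.filter fun w : Fin n → S => (cylinder w : Set (SFT F lam)).Nonempty :=
    Finset.mem_filter.2 ⟨Finset.mem_univ _, ⟨x, fun i => rfl⟩⟩
  refine le_trans ?_ (Finset.single_le_sum (fun w _ => (Real.exp_pos _).le) hmem)
  rw [← Real.exp_zero]
  refine Real.exp_le_exp.2 (le_of_eq ?_)
  have h : (fun y : SFT F lam => birkhoffSum shift (0 : SFT F lam → ℝ) n y) = fun _ => 0 := by
    funext y; simp [birkhoffSum]
  have hx : (cylinder (fun i : Fin n => x.1 i) : Set (SFT F lam)).Nonempty := ⟨x, fun i => rfl⟩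
  rw [h, hx.image_const, csSup_singleton]

lemma log_partitionFunction_div_le [Nonempty (SFT F lam)] {A B : SFT F lam → ℝ} {b c : ℝ}
    (hb : ∀ x, |B x| ≤ b) (h : ∀ x, A x ≤ B x + c) {n : ℕ} (hn : n ≠ 0) :
    Real.log (partitionFunction A n) / n ≤ c + Real.log (partitionFunction B n) / n := by
  have hn' : (0 : ℝ) < n := by positivity
  have h1 := Real.log_le_log (partitionFunction_pos A n) (partitionFunction_le hb h n)
  rw [Real.log_mul (Real.exp_pos _).ne' (partitionFunction_pos B n).ne', Real.log_exp] at h1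
  rw [div_le_iff₀ hn', add_mul, div_mul_cancel₀ _ hn'.ne']
  linarith

/-- The inequality holds for each `n ≠ 0` before the limit. Comparison with the zero potential, for
which `1 ≤ Z_n ≤ (card S) ^ n`, supplies the boundedness without which a real `limsup` is
meaningless. -/
lemma pressure_le [Nonempty (SFT F lam)] {A B : SFT F lam → ℝ} {a b c : ℝ}
    (ha : ∀ x, |A x| ≤ a) (hb : ∀ x, |B x| ≤ b) (h : ∀ x, A x ≤ B x + c) :
    pressure A ≤ c + pressure B := by
  have hlow : ∀ {A : SFT F lam → ℝ} {a : ℝ}, (∀ x, |A x| ≤ a) →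
      ∀ᶠ n : ℕ in atTop, -a ≤ Real.log (partitionFunction A n) / n := by
    intro A a ha
    filter_upwards [eventually_ne_atTop 0] with n hn
    have h1 := log_partitionFunction_div_le (A := 0) ha
      (c := a) (fun x => by have := (abs_le.1 (ha x)).1; simp; linarith) hn
    have h2 : 0 ≤ Real.log (partitionFunction (0 : SFT F lam → ℝ) n) / n :=
      div_nonneg (Real.log_nonneg (one_le_partitionFunction_zero n)) (by positivity)
    linarith
  have hup : ∀ {A : SFT F lam → ℝ} {a : ℝ}, (∀ x, |A x| ≤ a) →
      ∀ᶠ n : ℕ in atTop,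
        Real.log (partitionFunction A n) / n ≤ a + Real.log (Fintype.card S) := by
    intro A a ha
    filter_upwards [eventually_ne_atTop 0] with n hn
    have hn' : (0 : ℝ) < n := by positivity
    have h1 := log_partitionFunction_div_le (A := A) (B := 0) (b := 0) (by simp)
      (c := a) (fun x => by have := (abs_le.1 (ha x)).2; simpa) hn
    have h2 := Real.log_le_log (partitionFunction_pos (0 : SFT F lam → ℝ) n)
      (partitionFunction_zero_le n)
    rw [Real.log_pow] at h2
    have h3 : Real.log (partitionFunction (0 : SFT F lam → ℝ) n) / n ≤
        Real.log (Fintype.card S) := by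
      rw [div_le_iff₀ hn']; linarith
    linarith
  have hbB : IsBoundedUnder (· ≤ ·) atTop
      (fun n : ℕ => Real.log (partitionFunction B n) / n) := ⟨_, hup hb⟩
  have hcB : IsCoboundedUnder (· ≤ ·) atTop
      (fun n : ℕ => Real.log (partitionFunction B n) / n) :=
    IsBoundedUnder.isCoboundedUnder_le ⟨_, hlow hb⟩
  have hcA : IsCoboundedUnder (· ≤ ·) atTop
      (fun n : ℕ => Real.log (partitionFunction A n) / n) :=
    IsBoundedUnder.isCoboundedUnder_le ⟨_, hlow ha⟩
  unfold pressure
  rw [← limsup_const_add _ _ c hbB hcB]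
  refine limsup_le_limsup ?_ hcA ⟨c + (b + Real.log (Fintype.card S)), ?_⟩
  · filter_upwards [eventually_ne_atTop 0] with n hn
    exact log_partitionFunction_div_le hb h hn
  · refine eventually_map.2 ?_
    filter_upwards [hup hb] with n hn
    linarith

lemma pressure_sub_const [Nonempty (SFT F lam)] {A : SFT F lam → ℝ} {a : ℝ}
    (ha : ∀ x, |A x| ≤ a) (c : ℝ) : pressure (fun x => A x - c) = pressure A - c := by
  have h : ∀ x, |A x - c| ≤ a + |c| := fun x => (abs_sub _ _).trans (by gcongr; exact ha x)
  have h1 := pressure_le (c := -c) h ha fun x => by linarith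
  have h2 := pressure_le (c := c) ha h fun x => by linarith
  linarith

end SFT

/-! ### The Hölder norm through pointwise bounds -/

namespace HolderSpace

variable {X : Type*} [MetricSpace X] {α : ℝ≥0}

lemma holderWith_of_abs_sub_le {f : X → ℝ} {C : ℝ} (hC : 0 ≤ C) {γ : ℝ≥0}
    (h : ∀ x y, |f x - f y| ≤ C * dist x y ^ (γ : ℝ)) : HolderWith C.toNNReal γ f := by
  intro x y
  rw [edist_nndist, edist_nndist, ← ENNReal.coe_rpow_of_nonneg _ γ.coe_nonneg, ← ENNReal.coe_mul,
    ENNReal.coe_le_coe, ← NNReal.coe_le_coe, NNReal.coe_mul, NNReal.coe_rpow, coe_nndist,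
    coe_nndist]
  simpa [Real.coe_toNNReal _ hC, Real.dist_eq] using h x y

/-- The element of `C^α` given by a bounded function with a Hölder bound. -/
def ofBounds (hα : 0 < α) (f : X → ℝ) {b C : ℝ} (hb : ∀ x, |f x| ≤ b) (hC : 0 ≤ C)
    (h : ∀ x y, |f x - f y| ≤ C * dist x y ^ (α : ℝ)) : HolderSpace X α :=
  ⟨BoundedContinuousFunction.ofNormedAddCommGroup f
    ((holderWith_of_abs_sub_le hC h).continuous hα) b hb,
    (holderWith_of_abs_sub_le hC h).memHolder⟩

lemma norm_le (A : HolderSpace X α) {b C : ℝ} (hb0 : 0 ≤ b) (hb : ∀ x, |A x| ≤ b) (hC : 0 ≤ C)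
    (h : ∀ x y, |A x - A y| ≤ C * dist x y ^ (α : ℝ)) : ‖A‖ ≤ C + b := by
  refine add_le_add ?_ ((BoundedContinuousFunction.norm_le hb0).2 hb)
  have := (holderWith_of_abs_sub_le hC h).nnholderNorm_le
  rw [← Real.coe_toNNReal _ hC]
  exact_mod_cast this

lemma abs_apply_le (A : HolderSpace X α) (x : X) : |A x| ≤ ‖A‖ := by
  have h1 : |A x| ≤ ‖A.1‖ := A.1.norm_coe_le_norm x
  have h2 : ‖A‖ = (nnHolderNorm α A : ℝ) + ‖A.1‖ := rfl
  linarith [(nnHolderNorm α (A : X → ℝ)).coe_nonneg]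

lemma abs_sub_apply_le (A : HolderSpace X α) (x y : X) :
    |A x - A y| ≤ ‖A‖ * dist x y ^ (α : ℝ) := by
  have h1 := (MemHolder.holderWith A.2).dist_le x y
  have h2 : ‖A‖ = (nnHolderNorm α A : ℝ) + ‖A.1‖ := rfl
  have h3 : (nnHolderNorm α A : ℝ) ≤ ‖A‖ := by linarith [norm_nonneg A.1]
  refine h1.trans ?_
  gcongr

lemma sub_apply (A B : HolderSpace X α) (x : X) : (A - B) x = A x - B x := rfl

end HolderSpace

namespace SFT

variable {S : Type*} [Inhabited S] {F : Finset (SymbolicDynamics.FullShift.Pattern S ℕ)}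
  {lam : Set.Ioo (0 : ℝ) 1}

/-! ### Periodic orbits that maximize a function of finitely many coordinates -/

variable (F lam) in
/-- Membership in the subshift can be read off from the words of length `N`: a sequence belongs to
it as soon as each of its words of length `N` is an initial word of some point. -/
def IsWindow (N : ℕ) : Prop :=
  ∀ y : ℕ → S, (∀ t, ∃ x : SFT F lam, ∀ r < N, y (t + r) = x.1 r) →
    y ∈ SymbolicDynamics.FullShift.forbidden (F : Set (SymbolicDynamics.FullShift.Pattern S ℕ))

variable (F lam) in
-- A window longer than the largest coordinate in any forbidden pattern sees each occurrence whole,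
-- so an occurrence in `y` at `g` would give one in a point of the subshift at `0`.
lemma exists_isWindow : ∃ N₀, ∀ N ≥ N₀, IsWindow F lam N := by
  refine ⟨(F.sup fun p => p.support.sup id) + 1, fun N hN y hy p hp g hocc => ?_⟩
  obtain ⟨x, hx⟩ := hy g
  refine x.2 p hp 0 fun h hh => ?_
  have h1 : h ≤ p.support.sup id := Finset.le_sup (f := id) hh
  have h2 : p.support.sup id ≤ F.sup fun p => p.support.sup id :=
    Finset.le_sup (f := fun p => p.support.sup id) hp
  rw [zero_add, ← hx h (by omega)]
  exact hocc h hh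

lemma periodic_apply {p : SFT F lam} {q : ℕ} (hp : shift^[q] p = p) :
    Function.Periodic p.1 q := fun t => by
  rw [← shift_iterate_apply, hp]

lemma birkhoffSum_congr {A : SFT F lam → ℝ} {N : ℕ} (hA : DependsOnFirst N A) {n : ℕ}
    {x y : SFT F lam} (h : ∀ t < n + N, x.1 t = y.1 t) :
    birkhoffSum shift A n x = birkhoffSum shift A n y := by
  refine Finset.sum_congr rfl fun k hk => hA _ _ fun t ht => ?_
  rw [shift_iterate_apply, shift_iterate_apply]
  exact h _ (by have := Finset.mem_range.1 hk; omega)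

/-- If the same word of length `N` occurs in `x` at the positions `i` and `i + q`, then the segment
between the two can be cut out of `x` and closed up to a periodic point. -/
lemma exists_cut {N : ℕ} (hN : IsWindow F lam N) (x : SFT F lam) {i q : ℕ} (hq : 0 < q)
    (h : ∀ r < N, x.1 (i + r) = x.1 (i + q + r)) {A : SFT F lam → ℝ}
    (hA : DependsOnFirst N A) :
    ∃ p y : SFT F lam, shift^[q] p = p ∧ ∀ n,
      birkhoffSum shift A (i + q + n) x =
        birkhoffSum shift A (i + n) y + birkhoffSum shift A q p := by
  -- Repeating the block of length `q` reproduces `x` for `N` letters more, so every window of the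
  -- periodic sequence is a window of `x`.
  have hmod : ∀ s < q + N, x.1 (i + s % q) = x.1 (i + s) := by
    intro s
    induction s using Nat.strong_induction_on with
    | _ s ih =>
      intro hs
      rcases lt_or_ge s q with hsq | hsq
      · rw [Nat.mod_eq_of_lt hsq]
      · rw [Nat.mod_eq_sub_mod hsq, ih (s - q) (by omega) (by omega), h (s - q) (by omega)]
        exact congrArg x.1 (by omega)
  let p : SFT F lam := ⟨fun t => x.1 (i + t % q), hN _ fun t => ⟨shift^[i + t % q] x, fun r hr => by
    rw [shift_iterate_apply, ← Nat.mod_add_mod, hmod _ (by have := Nat.mod_lt t hq; omega)]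
    exact congrArg x.1 (by omega)⟩⟩
  -- A window that crosses the junction is still a window of `x`, since the letters after the cut
  -- agree with those from `i` on.
  let y : SFT F lam := ⟨fun t => if t < i then x.1 t else x.1 (t + q), hN _ fun t => by
    by_cases ht : t < i
    · refine ⟨shift^[t] x, fun r hr => ?_⟩
      rw [shift_iterate_apply]
      split_ifs with htr
      · rw [add_comm]
      · have := h (t + r - i) (by omega)
        rw [show r + t = i + (t + r - i) by omega, this]
        exact congrArg x.1 (by omega)
    · refine ⟨shift^[t + q] x, fun r hr => ?_⟩
      rw [shift_iterate_apply, if_neg (by omega)]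
      exact congrArg x.1 (by omega)⟩
  have hy1 : ∀ t < i + N, x.1 t = y.1 t := fun t ht => by
    change _ = if t < i then x.1 t else x.1 (t + q)
    split_ifs with hti
    · rfl
    · have := h (t - i) (by omega)
      rw [show t = i + (t - i) by omega, this]
      exact congrArg x.1 (by omega)
  refine ⟨p, y, Subtype.ext (funext fun t => ?_), fun n => ?_⟩
  · rw [shift_iterate_apply]
    change x.1 (i + (t + q) % q) = x.1 (i + t % q)
    rw [Nat.add_mod_right]
  · rw [birkhoffSum_add, birkhoffSum_add, birkhoffSum_add, birkhoffSum_congr hA hy1]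
    have h1 : birkhoffSum shift A q (shift^[i] x) = birkhoffSum shift A q p :=
      birkhoffSum_congr hA fun t ht => by
        rw [shift_iterate_apply, add_comm, ← hmod t ht]
    have h2 : shift^[i + q] x = shift^[i] y := Subtype.ext (funext fun t => by
      rw [shift_iterate_apply, shift_iterate_apply]
      change _ = if t + i < i then x.1 (t + i) else x.1 (t + i + q)
      rw [if_neg (by omega), add_assoc])
    rw [h1, h2]
    ring

variable [Fintype S]

variable (F lam) in
-- A point of period `q ≤ L` is determined by `q` and its first `L` letters.
lemma finite_periodic (L : ℕ) :
    {z : ℕ × SFT F lam | 0 < z.1 ∧ z.1 ≤ L ∧ shift^[z.1] z.2 = z.2}.Finite := by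
  rw [← Set.finite_coe_iff]
  let φ : {z : ℕ × SFT F lam | 0 < z.1 ∧ z.1 ≤ L ∧ shift^[z.1] z.2 = z.2} →
      Fin (L + 1) × (Fin L → S) :=
    fun z => (⟨z.1.1, Nat.lt_succ_of_le z.2.2.1⟩, fun i => z.1.2.1 i)
  refine Finite.of_injective φ ?_
  rintro ⟨⟨q, x⟩, hq0, hqL, hx⟩ ⟨⟨q', y⟩, hq0', hqL', hy⟩ h
  have h1 : q = q' := congrArg Fin.val (congrArg Prod.fst h)
  subst h1
  have h2 : x = y := Subtype.ext (funext fun t => by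
    have h3 := congrFun (congrArg Prod.snd h) ⟨t % q, (Nat.mod_lt _ hq0).trans_le hqL⟩
    rw [← (periodic_apply hx).map_mod_nat t, ← (periodic_apply hy).map_mod_nat t]
    exact h3)
  subst h2
  rfl

/-- For a function of finitely many coordinates, some periodic orbit maximizes the mean value, and
no Birkhoff sum exceeds what this mean value predicts by more than a constant. -/
lemma exists_maximal_periodic [Nonempty (SFT F lam)] {N : ℕ} (hN : IsWindow F lam N)
    {A : SFT F lam → ℝ} (hA : DependsOnFirst N A) {b : ℝ} (hb : ∀ x, |A x| ≤ b) :
    ∃ (q : ℕ) (p : SFT F lam), 0 < q ∧ shift^[q] p = p ∧ ∃ C, ∀ n x,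
      birkhoffSum shift A n x ≤ n * (birkhoffSum shift A q p / q) + C := by
  classical
  set L := Fintype.card (Fin N → S)
  -- There are `L` words of length `N` and `L + 1` starting positions `0, …, L`.
  have hpigeon : ∀ x : SFT F lam, ∃ i q, 0 < q ∧ i + q ≤ L ∧
      ∀ r < N, x.1 (i + r) = x.1 (i + q + r) := by
    intro x
    obtain ⟨a, c, hac, h⟩ := Fintype.exists_ne_map_eq_of_card_lt
      (fun (k : Fin (L + 1)) (r : Fin N) => x.1 (k + r)) (by simp [L])
    wlog hlt : a < c generalizing a c
    · exact this c a hac.symm h.symm (lt_of_le_of_ne (not_lt.1 hlt) hac.symm)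
    have hlt' : (a : ℕ) < c := hlt
    refine ⟨a, c - a, by omega, by omega, fun r hr => ?_⟩
    rw [show (a : ℕ) + (c - a) = c by omega]
    exact congrFun h ⟨r, hr⟩
  obtain ⟨⟨q, p⟩, ⟨hq0, hqL, hp⟩, hmax⟩ := Set.exists_max_image _
    (fun z : ℕ × SFT F lam => birkhoffSum shift A z.1 z.2 / z.1) (finite_periodic F lam L) (by
      obtain ⟨x⟩ := ‹Nonempty (SFT F lam)›
      obtain ⟨i, q, hq, hiq, h⟩ := hpigeon x
      obtain ⟨p, -, hp, -⟩ := exists_cut hN x hq h hA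
      exact ⟨(q, p), hq, by simp only; omega, hp⟩)
  set m := birkhoffSum shift A q p / q with hm
  -- The constant pays for the case `n ≤ L`. For longer sums, each loop cut out has mean at most `m`
  -- and costs nothing.
  refine ⟨q, p, hq0, hp, L * (b + |m|), fun n => ?_⟩
  induction n using Nat.strong_induction_on with
  | _ n ih =>
    intro x
    rcases le_or_gt n L with hnL | hnL
    · have h1 := (abs_le.1 (abs_birkhoffSum_le hb n x)).2
      have h2 : -|m| ≤ m := neg_abs_le m
      have hb0 : 0 ≤ b := (abs_nonneg _).trans (hb x)
      have h3 : (n : ℝ) ≤ L := by exact_mod_cast hnL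
      have h4 : (n : ℝ) * (b + |m|) ≤ L * (b + |m|) := by gcongr
      have h5 : (n : ℝ) * -|m| ≤ n * m := by gcongr
      linarith
    · obtain ⟨i, q', hq', hiq, h⟩ := hpigeon x
      obtain ⟨p', y, hp', hsum⟩ := exists_cut hN x hq' h hA
      obtain ⟨k, rfl⟩ : ∃ k, n = i + q' + k := ⟨n - (i + q'), by omega⟩
      have h1 := ih (i + k) (by omega) y
      have h2 := hmax (q', p') ⟨hq', by simp only; omega, hp'⟩
      have hq'' : (0 : ℝ) < q' := by exact_mod_cast hq'
      simp only at h2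
      rw [div_le_iff₀ hq''] at h2
      rw [hsum]
      push_cast at h1 ⊢
      linarith

end SFT

namespace SFT

variable {S : Type*} [Inhabited S] {F : Finset (SymbolicDynamics.FullShift.Pattern S ℕ)}
  {lam : Set.Ioo (0 : ℝ) 1}

/-! ### Shadowing of a periodic orbit -/

/-- The points that share the first `q + 1` coordinates with some point of the orbit of `p`. -/
def orbitNhd (p : SFT F lam) (q : ℕ) : Set (SFT F lam) :=
  {x | ∃ i, ∀ t ≤ q, x.1 t = p.1 (i + t)}

lemma dependsOnFirst_orbitNhd (p : SFT F lam) (q : ℕ) :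
    DependsOnFirst (q + 1) (· ∈ orbitNhd p q) := fun x y h => by
  refine propext (exists_congr fun i => forall₂_congr fun t ht => ?_)
  rw [h t (by omega)]

lemma measurableSet_orbitNhd (p : SFT F lam) (q : ℕ) : MeasurableSet (orbitNhd p q) :=
  (dependsOnFirst_orbitNhd p q).isOpen.measurableSet

variable {p : SFT F lam} {q : ℕ}

lemma iterate_mem_orbitNhd (k : ℕ) : shift^[k] p ∈ orbitNhd p q :=
  ⟨k, fun t _ => by rw [shift_iterate_apply, add_comm]⟩

/-- A visit to `orbitNhd` compares the letters `0` and `q`, whence `x (k + q) = x k` whatever the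
phase of that visit. Periodicity thus propagates the initial phase `i`. -/
lemma apply_eq_of_forall_mem_orbitNhd (hq : 0 < q) (hp : shift^[q] p = p) {x : SFT F lam} {i K : ℕ}
    (hi : ∀ t ≤ q, x.1 t = p.1 (i + t)) (hK : ∀ k < K, shift^[k] x ∈ orbitNhd p q) :
    ∀ t < K + q, x.1 t = p.1 (i + t) := by
  intro t
  induction t using Nat.strong_induction_on with
  | _ t ih =>
    intro ht
    rcases le_or_gt t q with htq | htq
    · exact hi t htq
    · obtain ⟨j, hj⟩ := hK (t - q) (by omega)
      have h1 := hj q le_rfl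
      have h0 := hj 0 (Nat.zero_le q)
      rw [shift_iterate_apply] at h0 h1
      have h2 := ih (t - q) (by omega) (by omega)
      have h3 := periodic_apply hp (i + (t - q))
      have h4 := periodic_apply hp j
      rw [show q + (t - q) = t by omega] at h1
      rw [show i + (t - q) + q = i + t by omega] at h3
      rw [zero_add] at h0
      rw [add_zero] at h0
      rw [h1, h4, ← h0, h2, h3]

/-- The map `n ↦ S_n g(p) - n * m` is `q`-periodic, hence bounded by `2 * q * δ`; starting at
`shift^[i] p` gives a difference of two of its values. -/
lemma abs_birkhoffSum_orbit_sub_le (hq : 0 < q) (hp : shift^[q] p = p) {g : SFT F lam → ℝ}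
    {δ : ℝ} (hg : ∀ x, |g x| ≤ δ) (i n : ℕ) :
    |birkhoffSum shift g n (shift^[i] p) - n * (birkhoffSum shift g q p / q)| ≤ 4 * q * δ := by
  have hq' : (0 : ℝ) < q := by exact_mod_cast hq
  set m := birkhoffSum shift g q p / q with hm
  let h : ℕ → ℝ := fun n => birkhoffSum shift g n p - n * m
  have hper : Function.Periodic h q := fun n => by
    have h1 : birkhoffSum shift g q p = q * m := by rw [hm]; field_simp
    simp only [h]
    rw [add_comm n q, birkhoffSum_add, hp, h1]
    push_cast
    ring
  have habs : ∀ n, |h n| ≤ 2 * q * δ := fun n => by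
    rw [← hper.map_mod_nat n]
    have h1 : ((n % q : ℕ) : ℝ) ≤ q := by exact_mod_cast (Nat.mod_lt n hq).le
    have h2 := abs_birkhoffSum_le hg (n % q) p
    have h3 : |m| ≤ δ := by
      rw [hm, abs_div, Nat.abs_cast, div_le_iff₀ hq', mul_comm]
      exact abs_birkhoffSum_le hg q p
    have hδ : 0 ≤ δ := (abs_nonneg _).trans (hg p)
    have h4 : |((n % q : ℕ) : ℝ) * m| ≤ q * δ := by
      rw [abs_mul, Nat.abs_cast]; gcongr
    have h5 : ((n % q : ℕ) : ℝ) * δ ≤ q * δ := by gcongr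
    refine (abs_sub _ _).trans ?_
    linarith
  have hsplit : birkhoffSum shift g n (shift^[i] p) - n * m = h (i + n) - h i := by
    simp only [h]
    rw [birkhoffSum_add]
    push_cast
    ring
  rw [hsplit]
  refine (abs_sub _ _).trans ?_
  linarith [habs (i + n), habs i]

variable {g : SFT F lam → ℝ} {δ α : ℝ}

/-- Along a segment of an orbit that stays close to the orbit of `p`, the Birkhoff sums of a Hölder
function grow like those along the orbit of `p`. -/
lemma birkhoffSum_le_of_forall_mem_orbitNhd (hq : 0 < q) (hp : shift^[q] p = p) (hα : 0 < α)
    (hg : ∀ x, |g x| ≤ δ) (hg' : ∀ x y, |g x - g y| ≤ δ * dist x y ^ α) {x : SFT F lam} {K : ℕ}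
    (hK : ∀ k < K, shift^[k] x ∈ orbitNhd p q) :
    birkhoffSum shift g K x ≤
      K * (birkhoffSum shift g q p / q) + δ * (1 / (1 - (lam : ℝ) ^ α) + 4 * q) := by
  have h0 : (0 : ℝ) < lam := lam.2.1
  have hδ : 0 ≤ δ := (abs_nonneg _).trans (hg p)
  set r : ℝ := (lam : ℝ) ^ α
  have hr0 : 0 ≤ r := Real.rpow_nonneg h0.le _
  have hr1 : 0 < 1 - r := sub_pos.2 (Real.rpow_lt_one h0.le lam.2.2 hα)
  rcases Nat.eq_zero_or_pos K with rfl | hK0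
  · simp only [birkhoffSum_zero, Nat.cast_zero, zero_mul, zero_add]
    positivity
  obtain ⟨i, hi⟩ := hK 0 hK0
  have hx : ∀ t < K + q, x.1 t = p.1 (i + t) := apply_eq_of_forall_mem_orbitNhd hq hp hi hK
  -- At time `k` at least `K - 1 - k` letters still agree with the periodic orbit, so the errors
  -- form a geometric series read backwards.
  have hterm : ∀ k ∈ Finset.range K,
      g (shift^[k] x) ≤ g (shift^[k] (shift^[i] p)) + δ * r ^ (K - 1 - k) := fun k hk => by
    have hk' := Finset.mem_range.1 hk
    have hd : dist (shift^[k] x) (shift^[k] (shift^[i] p)) ≤ (lam : ℝ) ^ (K - 1 - k) := by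
      rw [dist_le_pow_iff]
      intro t ht
      rw [shift_iterate_apply, shift_iterate_apply, shift_iterate_apply, hx _ (by omega)]
      exact congrArg p.1 (by omega)
    have h1 := (abs_le.1 (hg' (shift^[k] x) (shift^[k] (shift^[i] p)))).2
    have h2 : dist (shift^[k] x) (shift^[k] (shift^[i] p)) ^ α ≤ r ^ (K - 1 - k) := by
      refine (Real.rpow_le_rpow dist_nonneg hd hα.le).trans (le_of_eq ?_)
      rw [← Real.rpow_natCast, ← Real.rpow_natCast, ← Real.rpow_mul h0.le, ← Real.rpow_mul h0.le,
        mul_comm]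
    have h3 := mul_le_mul_of_nonneg_left h2 hδ
    linarith
  have hsum : birkhoffSum shift g K x ≤
      birkhoffSum shift g K (shift^[i] p) + δ * ∑ k ∈ Finset.range K, r ^ k := by
    refine (Finset.sum_le_sum hterm).trans (le_of_eq ?_)
    rw [Finset.sum_add_distrib, ← Finset.mul_sum, Finset.sum_range_reflect (fun k => r ^ k) K]
    rfl
  have hgeom : ∑ k ∈ Finset.range K, r ^ k ≤ 1 / (1 - r) := by
    rw [le_div_iff₀ hr1, geom_sum_mul_neg]
    linarith [pow_nonneg hr0 K]
  have h1 := (abs_le.1 (abs_birkhoffSum_orbit_sub_le hq hp hg i K)).2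
  have h2 := mul_le_mul_of_nonneg_left hgeom hδ
  linarith

/-- The indicator function of the points that are not close to the orbit of `p`. -/
def awayFromOrbit (p : SFT F lam) (q : ℕ) : SFT F lam → ℝ := (orbitNhd p q)ᶜ.indicator 1

lemma awayFromOrbit_of_mem {x : SFT F lam} (hx : x ∈ orbitNhd p q) : awayFromOrbit p q x = 0 :=
  Set.indicator_of_notMem (Set.notMem_compl_iff.2 hx) _

lemma awayFromOrbit_of_notMem {x : SFT F lam} (hx : x ∉ orbitNhd p q) :
    awayFromOrbit p q x = 1 :=
  Set.indicator_of_mem (s := (orbitNhd p q)ᶜ) hx _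

lemma abs_awayFromOrbit_le (x : SFT F lam) : |awayFromOrbit p q x| ≤ 1 := by
  by_cases hx : x ∈ orbitNhd p q
  · simp [awayFromOrbit_of_mem hx]
  · simp [awayFromOrbit_of_notMem hx]

lemma dependsOnFirst_awayFromOrbit : DependsOnFirst (q + 1) (awayFromOrbit p q) := fun x y h => by
  have hxy := dependsOnFirst_orbitNhd p q x y h
  by_cases hx : x ∈ orbitNhd p q
  · rw [awayFromOrbit_of_mem hx, awayFromOrbit_of_mem (hxy.mp hx)]
  · rw [awayFromOrbit_of_notMem hx, awayFromOrbit_of_notMem fun hy => hx (hxy.mpr hy)]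

lemma birkhoffSum_awayFromOrbit_orbit (n : ℕ) :
    birkhoffSum shift (awayFromOrbit p q) n p = 0 :=
  Finset.sum_eq_zero fun k _ => awayFromOrbit_of_mem (iterate_mem_orbitNhd k)

/-- Split the orbit at its visits away. Each stretch between them exceeds the mean by at most `δ *
c`; the visit itself adds at most `2 * δ`, because `g ≤ δ` and `m ≥ -δ`. The last summand is the
final stretch. -/
lemma birkhoffSum_le_add_awayFromOrbit (hq : 0 < q) (hp : shift^[q] p = p) (hα : 0 < α)
    (hg : ∀ x, |g x| ≤ δ) (hg' : ∀ x y, |g x - g y| ≤ δ * dist x y ^ α) (n : ℕ)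
    (x : SFT F lam) :
    birkhoffSum shift g n x ≤ n * (birkhoffSum shift g q p / q) +
      δ * (1 / (1 - (lam : ℝ) ^ α) + 4 * q + 2) * birkhoffSum shift (awayFromOrbit p q) n x +
      δ * (1 / (1 - (lam : ℝ) ^ α) + 4 * q) := by
  have hq' : (0 : ℝ) < q := by exact_mod_cast hq
  have hrun := fun (x : SFT F lam) (K : ℕ) =>
    birkhoffSum_le_of_forall_mem_orbitNhd (x := x) (K := K) hq hp hα hg hg'
  set c := 1 / (1 - (lam : ℝ) ^ α) + 4 * q
  set m := birkhoffSum shift g q p / q with hm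
  have hmδ : -δ ≤ m := by
    rw [hm, le_div_iff₀ hq']
    linarith [(abs_le.1 (abs_birkhoffSum_le hg q p)).1]
  induction n using Nat.strong_induction_on generalizing x with
  | _ n ih =>
    by_cases hall : ∀ k < n, shift^[k] x ∈ orbitNhd p q
    · have h1 : birkhoffSum shift (awayFromOrbit p q) n x = 0 :=
        Finset.sum_eq_zero fun k hk => awayFromOrbit_of_mem (hall k (Finset.mem_range.1 hk))
      rw [h1]
      linarith [hrun x n hall]
    · push Not at hall
      obtain ⟨K, ⟨hKn, hK⟩, hmin⟩ : ∃ K, (K < n ∧ shift^[K] x ∉ orbitNhd p q) ∧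
          ∀ k < K, shift^[k] x ∈ orbitNhd p q := by
        classical
        refine ⟨Nat.find hall, Nat.find_spec hall, fun k hk => ?_⟩
        by_contra hcon
        exact Nat.find_min hall hk ⟨hk.trans (Nat.find_spec hall).1, hcon⟩
      obtain ⟨l, rfl⟩ : ∃ l, n = K + 1 + l := ⟨n - (K + 1), by omega⟩
      have h1 := ih l (by omega) (shift^[K + 1] x)
      have h2 := hrun x K hmin
      have h3 : birkhoffSum shift (awayFromOrbit p q) K x = 0 :=
        Finset.sum_eq_zero fun k hk => awayFromOrbit_of_mem (hmin k (Finset.mem_range.1 hk))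
      have h4 := (abs_le.1 (hg (shift^[K] x))).2
      rw [birkhoffSum_add shift g (K + 1), birkhoffSum_add shift (awayFromOrbit p q) (K + 1),
        birkhoffSum_succ shift g K, birkhoffSum_succ shift (awayFromOrbit p q) K, h3,
        awayFromOrbit_of_notMem hK]
      push_cast
      linarith

/-! ### The invariant measure on a periodic orbit -/

/-- The uniform distribution on a periodic orbit. -/
def orbitMeasure (p : SFT F lam) (q : ℕ) : Measure (SFT F lam) :=
  (q : ℝ≥0∞)⁻¹ • ∑ k ∈ Finset.range q, Measure.dirac (shift^[k] p)

lemma isProbabilityMeasure_orbitMeasure (hq : 0 < q) :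
    IsProbabilityMeasure (orbitMeasure p q) := by
  refine ⟨?_⟩
  rw [orbitMeasure, Measure.smul_apply, Measure.finsetSum_apply]
  simp only [measure_univ, Finset.sum_const, Finset.card_range, nsmul_eq_mul, mul_one, smul_eq_mul]
  exact ENNReal.inv_mul_cancel (by exact_mod_cast hq.ne') (ENNReal.natCast_ne_top q)

lemma measurePreserving_orbitMeasure (hq : 0 < q) (hp : shift^[q] p = p) :
    MeasurePreserving shift (orbitMeasure p q) (orbitMeasure p q) := by
  have hmeas : Measurable (shift : SFT F lam → SFT F lam) := continuous_shift.measurable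
  refine ⟨hmeas, ?_⟩
  rw [orbitMeasure, Measure.map_smul]
  congr 1
  rw [← Measure.mapₗ_apply_of_measurable hmeas, map_sum]
  have hstep : ∀ k, Measure.mapₗ shift (Measure.dirac (shift^[k] p)) =
      Measure.dirac (shift^[k + 1] p) := fun k => by
    rw [Measure.mapₗ_apply_of_measurable hmeas, Measure.map_dirac' hmeas,
      Function.iterate_succ_apply']
  simp only [hstep]
  obtain ⟨l, rfl⟩ : ∃ l, q = l + 1 := ⟨q - 1, by omega⟩
  rw [Finset.sum_range_succ' (fun k => Measure.dirac (shift^[k] p)) l,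
    Finset.sum_range_succ (fun k => Measure.dirac (shift^[k + 1] p)) l, hp]
  rfl

lemma integral_orbitMeasure (f : SFT F lam → ℝ) :
    ∫ x, f x ∂(orbitMeasure p q) = birkhoffSum shift f q p / q := by
  rw [orbitMeasure, integral_smul_measure, integral_finsetSum_measure]
  · simp only [integral_dirac, birkhoffSum, smul_eq_mul, ENNReal.toReal_inv, ENNReal.toReal_natCast]
    rw [div_eq_inv_mul]
  · intro k _
    exact integrable_dirac (by simp)

/-- Bounds on Birkhoff sums bound the integral against an invariant measure. -/
lemma integral_le_of_birkhoffSum_le {X : Type*} [MeasurableSpace X] {T : X → X} {ν : Measure X}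
    [IsProbabilityMeasure ν] (hT : MeasurePreserving T ν ν) {f : X → ℝ} (hf : Integrable f ν)
    {c C : ℝ} (h : ∀ n : ℕ, ∀ᵐ x ∂ν, birkhoffSum T f n x ≤ n * c + C) : ∫ x, f x ∂ν ≤ c := by
  have hint : ∀ k, Integrable (fun x => f (T^[k] x)) ν := fun k =>
    (hT.iterate k).integrable_comp_of_integrable hf
  have hk : ∀ k, ∫ x, f (T^[k] x) ∂ν = ∫ x, f x ∂ν := fun k => by
    have h1 := (hT.iterate k).map_eq
    conv_rhs => rw [← h1]
    rw [integral_map (hT.iterate k).measurable.aemeasurable (by rw [h1]; exact hf.1)]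
  have hn : ∀ n : ℕ, n * ∫ x, f x ∂ν ≤ n * c + C := fun n => by
    have h1 : ∫ x, birkhoffSum T f n x ∂ν = n * ∫ x, f x ∂ν := by
      unfold birkhoffSum
      rw [integral_finsetSum _ fun k _ => hint k]
      simp [hk]
    have h2 : ∫ x, birkhoffSum T f n x ∂ν ≤ ∫ _, (n * c + C) ∂ν :=
      integral_mono_ae (integrable_finsetSum _ fun k _ => hint k) (integrable_const _) (h n)
    rw [h1] at h2
    simpa using h2
  by_contra hcon
  obtain ⟨n, hn'⟩ := exists_nat_gt (C / (∫ x, f x ∂ν - c))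
  rw [div_lt_iff₀ (by linarith)] at hn'
  linarith [hn n]

/-- By invariance almost every point stays in `orbitNhd` forever, so it lies on the orbit, where
Birkhoff sums differ boundedly from `n * mean`. Applying this to `f` and `-f` determines every
integral. -/
lemma eq_orbitMeasure_of_ae_mem (hq : 0 < q) (hp : shift^[q] p = p) {ν : Measure (SFT F lam)}
    [IsProbabilityMeasure ν] (hν : MeasurePreserving shift ν ν)
    (h : ∀ᵐ x ∂ν, x ∈ orbitNhd p q) : ν = orbitMeasure p q := by
  have := isProbabilityMeasure_orbitMeasure (p := p) hq
  have hall : ∀ᵐ x ∂ν, ∀ k, shift^[k] x ∈ orbitNhd p q :=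
    ae_all_iff.2 fun k => (hν.iterate k).quasiMeasurePreserving.ae h
  have horb : ∀ᵐ x ∂ν, ∃ i, x = shift^[i] p := by
    filter_upwards [hall] with x hx
    obtain ⟨i, hi⟩ := hx 0
    refine ⟨i, Subtype.ext (funext fun t => ?_)⟩
    rw [shift_iterate_apply, add_comm]
    exact apply_eq_of_forall_mem_orbitNhd hq hp hi (K := t + 1) (fun k _ => hx k) t (by omega)
  have hle : ∀ f : SFT F lam →ᵇ ℝ, ∫ x, f x ∂ν ≤ birkhoffSum shift f q p / q := fun f => by
    refine integral_le_of_birkhoffSum_le hν (f.integrable ν) (C := 4 * q * ‖f‖) fun n => ?_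
    filter_upwards [horb] with x hx
    obtain ⟨i, rfl⟩ := hx
    linarith [(abs_le.1 (abs_birkhoffSum_orbit_sub_le hq hp (fun x => f.norm_coe_le_norm x) i n)).2]
  refine ext_of_forall_integral_eq_of_IsFiniteMeasure fun f => ?_
  rw [integral_orbitMeasure]
  refine le_antisymm (hle f) ?_
  have h1 := hle (-f)
  have h2 : birkhoffSum shift (⇑(-f)) q p = -birkhoffSum shift f q p := by
    simp [birkhoffSum]
  rw [h2, neg_div] at h1
  simp only [BoundedContinuousFunction.coe_neg, Pi.neg_apply, integral_neg] at h1
  linarith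

/-- If the Birkhoff sums of `f` are controlled by the mean over a periodic orbit, with a penalty for
each visit away from this orbit, then the measure on the orbit is the only maximizing one. -/
lemma integral_le_of_penalty {f : SFT F lam →ᵇ ℝ} {ε C : ℝ}
    (hf : ∀ n x, birkhoffSum shift f n x ≤ n * (birkhoffSum shift f q p / q) -
      ε * birkhoffSum shift (awayFromOrbit p q) n x + C)
    {ν : Measure (SFT F lam)} [IsProbabilityMeasure ν] (hν : MeasurePreserving shift ν ν) :
    ∫ x, f x ∂ν + ε * ν.real (orbitNhd p q)ᶜ ≤ ∫ x, f x ∂(orbitMeasure p q) := by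
  have hU : MeasurableSet (orbitNhd p q)ᶜ := (measurableSet_orbitNhd p q).compl
  have hi : Integrable (awayFromOrbit p q) ν :=
    (integrable_const (1 : ℝ)).indicator hU
  have h1 : ∫ x, awayFromOrbit p q x ∂ν = ν.real (orbitNhd p q)ᶜ := integral_indicator_one hU
  rw [← h1, ← integral_const_mul, ← integral_add (f.integrable ν) (hi.const_mul ε),
    integral_orbitMeasure]
  refine integral_le_of_birkhoffSum_le hν ((f.integrable ν).add (hi.const_mul ε)) (C := C)
    fun n => Eventually.of_forall fun x => ?_
  have h2 : birkhoffSum shift (⇑f + fun x => ε * awayFromOrbit p q x) n x =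
      birkhoffSum shift f n x + ε * birkhoffSum shift (awayFromOrbit p q) n x := by
    simp only [birkhoffSum, Pi.add_apply, Finset.sum_add_distrib, Finset.mul_sum]
  linarith [hf n x]

end SFT

/-! ### Robustness of the penalized orbit, and density -/

namespace SFT

variable {S : Type*} [Inhabited S] {F : Finset (SymbolicDynamics.FullShift.Pattern S ℕ)}
  {lam : Set.Ioo (0 : ℝ) 1} {p : SFT F lam} {q : ℕ} {α : ℝ≥0}

lemma birkhoffSum_sub_awayFromOrbit (A : SFT F lam → ℝ) (e c : ℝ) (n : ℕ) (x : SFT F lam) :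
    birkhoffSum shift (fun x => A x - e * awayFromOrbit p q x - c) n x =
      birkhoffSum shift A n x - e * birkhoffSum shift (awayFromOrbit p q) n x - n * c := by
  simp [birkhoffSum, Finset.sum_sub_distrib, Finset.mul_sum]

/-- A periodic orbit with a penalty for visits away from it maximizes all nearby Hölder functions,
again with a penalty. -/
lemma exists_radius_integral_le (hq : 0 < q) (hp : shift^[q] p = p) (hα : 0 < α)
    {B : HolderSpace (SFT F lam) α} {ε C : ℝ} (hε : 0 < ε)
    (hB : ∀ n x, birkhoffSum shift B n x ≤ n * (birkhoffSum shift B q p / q) -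
      ε * birkhoffSum shift (awayFromOrbit p q) n x + C) :
    ∃ δ > 0, ∀ f : HolderSpace (SFT F lam) α, ‖f - B‖ ≤ δ →
      ∀ (ν : Measure (SFT F lam)) [IsProbabilityMeasure ν], MeasurePreserving shift ν ν →
        ∫ x, f x ∂ν + ε / 2 * ν.real (orbitNhd p q)ᶜ ≤ ∫ x, f x ∂(orbitMeasure p q) := by
  have hα' : (0 : ℝ) < α := hα
  have hr1 : 0 < 1 - (lam : ℝ) ^ (α : ℝ) :=
    sub_pos.2 (Real.rpow_lt_one lam.2.1.le lam.2.2 hα')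
  have hc : 0 < 1 / (1 - (lam : ℝ) ^ (α : ℝ)) + 4 * q + 2 := by positivity
  -- With this radius the perturbation earns at most `ε / 2` per visit away, half of the penalty.
  refine ⟨ε / 2 / (1 / (1 - (lam : ℝ) ^ (α : ℝ)) + 4 * q + 2), by positivity,
    fun f hf ν _ hν => ?_⟩
  set δ := ε / 2 / (1 / (1 - (lam : ℝ) ^ (α : ℝ)) + 4 * q + 2) with hδ
  have hδc : δ * (1 / (1 - (lam : ℝ) ^ (α : ℝ)) + 4 * q + 2) = ε / 2 := by
    rw [hδ]; field_simp
  have hg := birkhoffSum_le_add_awayFromOrbit (g := ⇑(f - B).1) hq hp hα'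
    (fun x => ((f - B).abs_apply_le x).trans hf)
    (fun x y => ((f - B).abs_sub_apply_le x y).trans (by gcongr))
  rw [hδc] at hg
  refine integral_le_of_penalty (f := f.1)
    (C := C + δ * (1 / (1 - (lam : ℝ) ^ (α : ℝ)) + 4 * q)) (fun n x => ?_) hν
  have hsum : ∀ n x, birkhoffSum shift f n x =
      birkhoffSum shift B n x + birkhoffSum shift (f - B).1 n x := fun n x => by
    unfold birkhoffSum
    rw [← Finset.sum_add_distrib]
    refine Finset.sum_congr rfl fun k _ => ?_
    have := HolderSpace.sub_apply f B (shift^[k] x)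
    linarith
  have h1 := hg n x
  have h2 := hB n x
  rw [hsum n x, hsum q p, add_div]
  linarith

/-- Functions near which a periodic orbit stays uniquely maximizing have the continuously varying
support property. -/
lemma exists_unique_maximizing_of_radius (hq : 0 < q) (hp : shift^[q] p = p)
    {B : HolderSpace (SFT F lam) α} {ε δ : ℝ} (hε : 0 < ε) (hδ : 0 < δ)
    (h : ∀ f : HolderSpace (SFT F lam) α, ‖f - B‖ ≤ δ →
      ∀ (ν : Measure (SFT F lam)) [IsProbabilityMeasure ν], MeasurePreserving shift ν ν →
        ∫ x, f x ∂ν + ε * ν.real (orbitNhd p q)ᶜ ≤ ∫ x, f x ∂(orbitMeasure p q))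
    [Fintype S] :
    ∃ μ : ProbabilityMeasure (SFT F lam), IsMaximizingMeasure B μ ∧
      (∀ ν, IsMaximizingMeasure B ν → ν = μ) ∧ HasContinuouslyVaryingSupport B μ := by
  let μ : ProbabilityMeasure (SFT F lam) :=
    ⟨orbitMeasure p q, isProbabilityMeasure_orbitMeasure hq⟩
  have hμ : MeasurePreserving shift (μ : Measure (SFT F lam)) μ :=
    measurePreserving_orbitMeasure hq hp
  have huniq : ∀ f : HolderSpace (SFT F lam) α, ‖f - B‖ ≤ δ → ∀ ν, IsMaximizingMeasure f ν →
      ν = μ := fun f hf ν hν => by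
    have h1 := h f hf (ν : Measure (SFT F lam)) hν.1
    have h2 : ∫ x, f x ∂(orbitMeasure p q) ≤ ∫ x, f x ∂ν := hν.2 μ hμ
    have h3 : (ν : Measure (SFT F lam)).real (orbitNhd p q)ᶜ ≤ 0 :=
      nonpos_of_mul_nonpos_right (by linarith) hε
    have h4 : (ν : Measure (SFT F lam)) (orbitNhd p q)ᶜ = 0 :=
      (measureReal_eq_zero_iff).1 (le_antisymm h3 measureReal_nonneg)
    have h5 : (ν : Measure (SFT F lam)) = orbitMeasure p q :=
      eq_orbitMeasure_of_ae_mem hq hp hν.1 h4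
    exact Subtype.ext h5
  have hBB : ‖B - B‖ ≤ δ := by rw [sub_self, norm_zero]; exact hδ.le
  refine ⟨μ, ⟨hμ, fun ν hν => ?_⟩, huniq B hBB, fun An μn _ hA hμn => ?_⟩
  · have h1 := h B hBB (ν : Measure (SFT F lam)) hν
    have h2 : 0 ≤ ε * (ν : Measure (SFT F lam)).real (orbitNhd p q)ᶜ := by positivity
    exact (by linarith : ∫ x, B x ∂ν ≤ ∫ x, B x ∂(orbitMeasure p q))
  -- Once `An n` is within `δ` of `B`, uniqueness forces `μn n` to equal `μ`.
  · have hev : ∀ᶠ n in atTop, μ = μn n := by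
      filter_upwards [(tendsto_iff_norm_sub_tendsto_zero.1 hA).eventually (ge_mem_nhds hδ)] with n hn
      exact (huniq _ hn _ (hμn n)).symm
    refine ⟨tendsto_const_nhds.congr' hev, tendsto_const_nhds.congr' ?_⟩
    filter_upwards [hev] with n hn
    rw [← hn, Metric.hausdorffEDist_self]

/-- Near a Hölder function of larger exponent and zero pressure there is a function of finitely many
coordinates that has zero pressure and a robustly maximizing periodic orbit. -/
lemma exists_locked_near [Fintype S] [Nonempty (SFT F lam)] (hα : 0 < α)
    {A : HolderSpace (SFT F lam) α} (hA0 : pressure A = 0) {γ : ℝ≥0} (hαγ : α < γ)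
    (hA : MemHolder γ A) {ε : ℝ} (hε : 0 < ε) :
    ∃ B : HolderSpace (SFT F lam) α, ‖B - A‖ < ε ∧ pressure B = 0 ∧
      MemHolder (α + 1) B ∧ ∃ μ : ProbabilityMeasure (SFT F lam), IsMaximizingMeasure B μ ∧
        (∀ ν, IsMaximizingMeasure B ν → ν = μ) ∧ HasContinuouslyVaryingSupport B μ := by
  have h0 : (0 : ℝ) < lam := lam.2.1
  have hα' : (0 : ℝ) < α := hα
  have hαγ' : (α : ℝ) < γ := hαγ
  obtain ⟨C, hC⟩ := hA
  obtain ⟨N₀, hN₀⟩ := exists_isWindow F lam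
  have hsmall : Tendsto (fun N : ℕ => 2 * (C : ℝ) * ((lam : ℝ) ^ N) ^ ((γ : ℝ) - α)) atTop
      (𝓝 0) := by
    have h1 : Tendsto (fun N : ℕ => ((lam : ℝ) ^ ((γ : ℝ) - α)) ^ N) atTop (𝓝 0) :=
      tendsto_pow_atTop_nhds_zero_of_lt_one (Real.rpow_nonneg h0.le _)
        (Real.rpow_lt_one h0.le lam.2.2 (by linarith))
    have h2 := h1.const_mul (2 * (C : ℝ))
    rw [mul_zero] at h2
    refine h2.congr fun N => ?_
    rw [← Real.rpow_natCast, ← Real.rpow_natCast, ← Real.rpow_mul h0.le, ← Real.rpow_mul h0.le,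
      mul_comm ((γ : ℝ) - α)]
  obtain ⟨N, hNε, hN⟩ := ((hsmall.eventually (gt_mem_nhds (show 0 < ε / 8 by positivity))).and
    (eventually_ge_atTop N₀)).exists
  obtain ⟨A', hA', hval, hsup, hhol⟩ := exists_dependsOnFirst_approx (A := A) C.coe_nonneg hα'.le
    hαγ'.le (fun x y => by simpa [Real.dist_eq] using hC.dist_le x y) N
  set η := 2 * (C : ℝ) * ((lam : ℝ) ^ N) ^ ((γ : ℝ) - α)
  have hA'b : ∀ x, |A' x| ≤ ‖A‖ := fun x => by
    obtain ⟨y, hy⟩ := hval x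
    rw [hy]
    exact A.abs_apply_le y
  obtain ⟨q, p, hq, hp, C₁, hmax⟩ := exists_maximal_periodic (hN₀ N hN) hA' hA'b
  have hM : (0 : ℝ) < (lam : ℝ) ^ (q + 1) := pow_pos h0 _
  set L : ℝ := 2 * 1 / ((lam : ℝ) ^ (q + 1)) ^ (α : ℝ)
  have hL : 0 ≤ L := by positivity
  have hawayHol : ∀ x y : SFT F lam, |awayFromOrbit p q x - awayFromOrbit p q y| ≤
      L * dist x y ^ (α : ℝ) :=
    dependsOnFirst_awayFromOrbit.abs_sub_le abs_awayFromOrbit_le hα'.le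
  -- The Hölder constant `L` depends on the orbit, so `e` is chosen after it; both `e` and `e * L`
  -- are at most `ε / 8`.
  set e : ℝ := ε / (8 * (L + 1)) with he
  have he0 : 0 < e := by positivity
  have heL : e * (L + 1) = ε / 8 := by rw [he]; field_simp
  have heL0 : 0 ≤ e * L := by positivity
  have haway : ∀ x : SFT F lam, |e * awayFromOrbit p q x| ≤ e := fun x => by
    rw [abs_mul, abs_of_pos he0]
    exact mul_le_of_le_one_right he0.le (abs_awayFromOrbit_le x)
  set B₀ : SFT F lam → ℝ := fun x => A' x - e * awayFromOrbit p q x with hB₀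
  have hB₀b : ∀ x, |B₀ x| ≤ ‖A‖ + e := fun x =>
    (abs_sub _ _).trans (add_le_add (hA'b x) (haway x))
  have hB₀A : ∀ x, |B₀ x - A x| ≤ ε / 4 := fun x => by
    have h1 : B₀ x - A x = (A' x - A x) - e * awayFromOrbit p q x := by simp only [hB₀]; ring
    rw [h1]
    refine (abs_sub _ _).trans ?_
    linarith [hsup x, haway x]
  -- As `A` has zero pressure, that of `B₀` is at most the uniform distance between them.
  have hc : |pressure B₀| ≤ ε / 4 := by
    rw [abs_le]
    have h1 := pressure_le (c := ε / 4) hB₀b A.abs_apply_le fun x => by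
      linarith [(abs_le.1 (hB₀A x)).2]
    have h2 := pressure_le (c := ε / 4) A.abs_apply_le hB₀b fun x => by
      linarith [(abs_le.1 (hB₀A x)).1]
    constructor <;> linarith
  set c := pressure B₀ with hcdef
  set f : SFT F lam → ℝ := fun x => A' x - e * awayFromOrbit p q x - c with hf
  have hfb : ∀ x, |f x| ≤ ‖A‖ + e + |c| := fun x =>
    (abs_sub _ _).trans (by gcongr; exact hB₀b x)
  have hfdep : DependsOnFirst (max N (q + 1)) f := fun x y hxy => by
    simp only [hf]
    rw [hA'.mono (le_max_left _ _) x y hxy,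
      (dependsOnFirst_awayFromOrbit (p := p) (q := q)).mono (le_max_right _ _) x y hxy]
  have hM' : (0 : ℝ) < (lam : ℝ) ^ max N (q + 1) := pow_pos h0 _
  let B : HolderSpace (SFT F lam) α := HolderSpace.ofBounds hα f hfb (by positivity)
    (hfdep.abs_sub_le hfb hα'.le)
  have hBf : ∀ x, B x = f x := fun x => rfl
  have hnorm : ‖B - A‖ ≤ ε / 4 + (ε / 4 + ε / 4) := by
    refine HolderSpace.norm_le _ (by positivity) (fun x => ?_) (by positivity) fun x y => ?_
    · rw [HolderSpace.sub_apply, hBf]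
      have h1 : f x - A x = (B₀ x - A x) - c := by simp only [hf, hB₀]; ring
      rw [h1]
      exact (abs_sub _ _).trans (add_le_add (hB₀A x) hc)
    · rw [HolderSpace.sub_apply, HolderSpace.sub_apply, hBf, hBf]
      have h1 : f x - A x - (f y - A y) = ((A' x - A x) - (A' y - A y)) -
          e * (awayFromOrbit p q x - awayFromOrbit p q y) := by simp only [hf]; ring
      rw [h1]
      refine (abs_sub _ _).trans ?_
      rw [abs_mul, abs_of_pos he0]
      have hd : 0 ≤ dist x y ^ (α : ℝ) := by positivity
      calc _ ≤ η * dist x y ^ (α : ℝ) + e * (L * dist x y ^ (α : ℝ)) :=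
            add_le_add (hhol x y) (mul_le_mul_of_nonneg_left (hawayHol x y) he0.le)
        _ = (η + e * L) * dist x y ^ (α : ℝ) := by ring
        _ ≤ _ := mul_le_mul_of_nonneg_right (by linarith) hd
  -- The penalty vanishes along the orbit of `p`, so the mean of `f` there is that of `A'` minus
  -- `c`, and `hmax` becomes the penalized bound.
  obtain ⟨δ, hδ, hrad⟩ := exists_radius_integral_le (B := B) (C := C₁) hq hp hα he0 fun n x => by
    change birkhoffSum shift f n x ≤ n * (birkhoffSum shift f q p / q) - _ + _
    have hq' : (q : ℝ) ≠ 0 := by exact_mod_cast hq.ne'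
    rw [hf, birkhoffSum_sub_awayFromOrbit, birkhoffSum_sub_awayFromOrbit,
      birkhoffSum_awayFromOrbit_orbit, mul_zero, sub_zero, sub_div, mul_div_cancel_left₀ _ hq',
      mul_sub]
    linarith [hmax n x]
  refine ⟨B, by linarith, ?_, ?_, exists_unique_maximizing_of_radius hq hp (half_pos he0) hδ hrad⟩
  · exact (pressure_sub_const hB₀b c).trans (by rw [← hcdef, sub_self])
  -- A function of finitely many coordinates is Hölder of every exponent; `α + 1` is merely one
  -- above `α`.
  · refine (HolderSpace.holderWith_of_abs_sub_le
      (C := 2 * (‖A‖ + e + |c|) / ((lam : ℝ) ^ max N (q + 1)) ^ ((α + 1 : ℝ≥0) : ℝ))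
      (by positivity) fun x y => ?_).memHolder
    exact hfdep.abs_sub_le hfb (NNReal.coe_nonneg _) x y

end SFT

end

theorem theoremC {S : Type*} [Fintype S] [Inhabited S]
    (F : Finset (SymbolicDynamics.FullShift.Pattern S ℕ)) (lam : Set.Ioo (0 : ℝ) 1)
    (hne : Nonempty (SFT F lam))
    (hmix : IsTopologicallyMixing (SFT.shift : SFT F lam → SFT F lam))
    (α : ℝ≥0) (hα : 0 < α) (hα1 : α ≤ 1) :
    ∃ D : Set (HolderSpace (SFT F lam) α),
      D ⊆ zeroPressurePlus F lam α ∧ zeroPressurePlus F lam α ⊆ closure D ∧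
      ∀ A ∈ D, ∃ μ : ProbabilityMeasure (SFT F lam),
        IsMaximizingMeasure A μ ∧ (∀ ν, IsMaximizingMeasure A ν → ν = μ) ∧
        HasContinuouslyVaryingSupport A μ := by
  refine ⟨{A | A ∈ zeroPressurePlus F lam α ∧ ∃ μ : ProbabilityMeasure (SFT F lam),
    IsMaximizingMeasure A μ ∧ (∀ ν, IsMaximizingMeasure A ν → ν = μ) ∧
    HasContinuouslyVaryingSupport A μ}, fun A hA => hA.1, ?_, fun A hA => hA.2⟩
  -- It suffices to approximate the generating functions, since `closure D` is closed.
  refine closure_minimal (fun A hA => ?_) isClosed_closure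
  obtain ⟨hA0, γ, hγ, hA⟩ := hA
  refine Metric.mem_closure_iff.2 fun ε hε => ?_
  obtain ⟨B, hBA, hB0, hB, hμ⟩ := SFT.exists_locked_near hα hA0 hγ hA hε
  refine ⟨B, ⟨subset_closure ⟨hB0, α + 1, lt_add_one α, hB⟩, hμ⟩, ?_⟩
  rwa [dist_comm, dist_eq_norm]
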